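/- A polynomial endofunctor on $\mathbf{Set}/I$ is given by a diagram of sets $I\xleftarrow{s}E\xrightarrow{p}B\xrightarrow{t}I$ in which $p$ has finite fibres $E_b=p^{-1}(b)$. A polynomial monad on $\mathbf{Set}/I$ is a polynomial endofunctor $P$ with cartesian natural transformations $\mathrm{Id}\Rightarrow P$ and $P\circ P\Rightarrow P$ satisfying the unit and associativity laws. An abstract tree is a finite connected and simply connected graph with a set of vertices of valence $1$, called the boundary, and a chosen boundary vertex, the output vertex; its nodes are the vertices not in the boundary. The output edge of a node is its incident edge in the direction of the output vertex, and its other incident edges are its input edges. A decoration of an abstract tree by $I\xleftarrow{s}E\xrightarrow{p}B\xrightarrow{t}I$ consists of a map from its edges to $I$, a map from its nodes to $B$, and, for each node $n$ with decoration $b$, a bijection between the input edges of $n$ and $E_b$, such that an input edge corresponding to $e\in E_b$ has decoration $s(e)$ and the output edge of $n$ has decoration $t(b)$. An abstract tree with such a decoration by $P$ is called a $P$-tree; $\operatorname{tr}(P)$ denotes the set of isomorphism classes of $P$-trees, and $\operatorname{tr}^\bullet(P)$ the set of isomorphism classes of $P$-trees with a marked node. For a polynomial monad $P$ as above, the Baez–Dolan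 construction $P^+$ is the polynomial monad on $\mathbf{Set}/B$ whose underlying endofunctor is given by $B\leftarrow\operatorname{tr}^\bullet(P)\to\operatorname{tr}(P)\to B$; the maps return, respectively, the element of $B$ decorating the marked node, the $P$-tree without its mark, and the element of $B$ obtained by contracting all inner edges by means of the monad structure of $P$ (where the unit tree with edge $i$ is sent to the unit operation of $i$). **Corollary.** Let $P$ be a polynomial monad on $\mathbf{Set}/I$ with $I\neq\emptyset$. Then every abstract tree admits a decoration by $P^+$. -/

import Mathlib

/-! ### Polynomial endofunctors and polynomial monads -/

universe u v

/-- A polynomial endofunctor on `Set/I`, given by its representing diagram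
`I ← E → B → I` (maps `s`, `p`, `t`), where `p` has finite fibres.
`B` is the set of operations, and the fibre `E_b` is the set of inputs of the operation `b`. -/
structure PolyEndo (I : Type u) where
  E : Type u
  B : Type u
  s : E → I
  p : E → B
  t : B → I
  finite_fibre : ∀ b : B, Finite {e : E // p e = b}

namespace PolyEndo

/-- The fibre `E_b` of `p : E → B`. -/
abbrev Fib {I : Type u} (P : PolyEndo I) (b : P.B) : Type u := {e : P.E // P.p e = b}

/-- The identity functor of `Set/I`, represented by `I ← I → I → I`. -/
def idPoly (I : Type u) : PolyEndo I where
  E := I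
  B := I
  s := id
  p := id
  t := id
  finite_fibre b := Finite.of_injective (fun _ : {e : I // id e = b} => ())
    (fun x y _ => Subtype.ext (x.2.trans y.2.symm))

/-- A bouquet of bouquets (a two-level tree): an operation `bot`, and for each of its inputs `e` an
operation `top e` whose output type is the type of `e`. These are the operations of `P ∘ P`. -/
structure TwoLevel {I : Type u} (P : PolyEndo I) where
  bot : P.B
  top : P.Fib bot → P.B
  compat : ∀ e : P.Fib bot, P.t (top e) = P.s e.1

/-- The inputs of a two-level tree are the inputs of its upper operations. -/
abbrev TwoLevel.In {I : Type u} {P : PolyEndo I} (x : P.TwoLevel) : Type u :=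
  Σ e : P.Fib x.bot, P.Fib (x.top e)

theorem TwoLevel.finite_in {I : Type u} {P : PolyEndo I} (x : P.TwoLevel) : Finite x.In := by
  have := P.finite_fibre x.bot
  have : ∀ e, Finite (P.Fib (x.top e)) := fun e => P.finite_fibre (x.top e)
  infer_instance

theorem finite_sigma_fibre {α : Type u} {β : α → Type u} (h : ∀ a, Finite (β a)) (a : α) :
    Finite {y : Σ a, β a // y.1 = a} := by
  have := h a
  refine Finite.of_surjective (fun b : β a => (⟨⟨a, b⟩, rfl⟩ : {y : Σ a, β a // y.1 = a})) ?_
  rintro ⟨⟨a', b⟩, rfl⟩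
  exact ⟨b, rfl⟩

/-- The composite `P ∘ P`. -/
def square {I : Type u} (P : PolyEndo I) : PolyEndo I where
  E := Σ x : P.TwoLevel, x.In
  B := P.TwoLevel
  s y := P.s y.2.2.1
  p y := y.1
  t x := P.t x.bot
  finite_fibre x := finite_sigma_fibre TwoLevel.finite_in x

/-- A morphism of `Poly(I)`: a cartesian natural transformation `P' ⇒ P`, that is, a commutative
diagram between the representing diagrams whose middle square is cartesian. -/
structure Hom {I : Type u} (P' P : PolyEndo I) where
  onE : P'.E → P.E
  onB : P'.B → P.B
  s_onE : ∀ e, P.s (onE e) = P'.s e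
  p_onE : ∀ e, P.p (onE e) = onB (P'.p e)
  t_onB : ∀ b, P.t (onB b) = P'.t b
  /-- The fibre over `b'` is mapped bijectively to the fibre over the image of `b'`. -/
  cartesian : ∀ (b' : P'.B) (e : P.E), P.p e = onB b' → ∃! e' : P'.E, P'.p e' = b' ∧ onE e' = e

end PolyEndo

/-- A polynomial monad on `Set/I`: a polynomial endofunctor together with cartesian natural
transformations `η : Id ⇒ P` and `μ : P ∘ P ⇒ P` that satisfy the unit and associativity laws.
Each law is an equality of morphisms in `Poly(I)`, hence is stated on operations and on inputs. -/
structure PolyMonad (I : Type u) extends PolyEndo I where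
  η : PolyEndo.Hom (PolyEndo.idPoly I) toPolyEndo
  μ : PolyEndo.Hom toPolyEndo.square toPolyEndo
  /-- Grafting `b` onto the unit operation of its output type gives `b`. -/
  unit_bot : ∀ (b : B) (h : ∀ e : toPolyEndo.Fib (η.onB (t b)), t b = s e.1),
    μ.onB ⟨η.onB (t b), fun _ => b, h⟩ = b
  unit_bot_in : ∀ (b : B) (h : ∀ e : toPolyEndo.Fib (η.onB (t b)), t b = s e.1)
    (e : toPolyEndo.Fib (η.onB (t b))) (e' : toPolyEndo.Fib b),
    μ.onE ⟨⟨η.onB (t b), fun _ => b, h⟩, e, e'⟩ = e'.1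
  /-- Grafting unit operations onto all the inputs of `b` gives `b`. -/
  unit_top : ∀ (b : B) (h : ∀ e : toPolyEndo.Fib b, t (η.onB (s e.1)) = s e.1),
    μ.onB ⟨b, fun e => η.onB (s e.1), h⟩ = b
  unit_top_in : ∀ (b : B) (h : ∀ e : toPolyEndo.Fib b, t (η.onB (s e.1)) = s e.1)
    (e : toPolyEndo.Fib b) (e' : toPolyEndo.Fib (η.onB (s e.1))),
    μ.onE ⟨⟨b, fun e => η.onB (s e.1), h⟩, e, e'⟩ = e.1
  /-- A three-level tree, given as a two-level tree `x` with operations `d` grafted onto its inputs,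
  can be contracted from the bottom or from the top. The family `d` is indexed by the inputs of the
  contraction of `x`, which are the inputs of `x` because `μ` is cartesian. -/
  assoc : ∀ (x : toPolyEndo.TwoLevel) (d : toPolyEndo.Fib (μ.onB x) → B)
    (h : ∀ a, t (d a) = s a.1)
    (h' : ∀ (e : toPolyEndo.Fib x.bot) (e' : toPolyEndo.Fib (x.top e)),
      t (d ⟨μ.onE ⟨x, e, e'⟩, μ.p_onE ⟨x, e, e'⟩⟩) = s e'.1)
    (h'' : ∀ e : toPolyEndo.Fib x.bot,
      t (μ.onB ⟨x.top e, fun e' => d ⟨μ.onE ⟨x, e, e'⟩, μ.p_onE ⟨x, e, e'⟩⟩, h' e⟩) = s e.1),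
    μ.onB ⟨μ.onB x, d, h⟩ =
      μ.onB ⟨x.bot, fun e => μ.onB
        ⟨x.top e, fun e' => d ⟨μ.onE ⟨x, e, e'⟩, μ.p_onE ⟨x, e, e'⟩⟩, h' e⟩, h''⟩
  assoc_in : ∀ (x : toPolyEndo.TwoLevel) (d : toPolyEndo.Fib (μ.onB x) → B)
    (h : ∀ a, t (d a) = s a.1)
    (h' : ∀ (e : toPolyEndo.Fib x.bot) (e' : toPolyEndo.Fib (x.top e)),
      t (d ⟨μ.onE ⟨x, e, e'⟩, μ.p_onE ⟨x, e, e'⟩⟩) = s e'.1)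
    (h'' : ∀ e : toPolyEndo.Fib x.bot,
      t (μ.onB ⟨x.top e, fun e' => d ⟨μ.onE ⟨x, e, e'⟩, μ.p_onE ⟨x, e, e'⟩⟩, h' e⟩) = s e.1)
    (e : toPolyEndo.Fib x.bot) (e' : toPolyEndo.Fib (x.top e))
    (e'' : toPolyEndo.Fib (d ⟨μ.onE ⟨x, e, e'⟩, μ.p_onE ⟨x, e, e'⟩⟩)),
    μ.onE ⟨⟨μ.onB x, d, h⟩, ⟨μ.onE ⟨x, e, e'⟩, μ.p_onE ⟨x, e, e'⟩⟩, e''⟩ =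
      μ.onE ⟨⟨x.bot, fun e => μ.onB
          ⟨x.top e, fun e' => d ⟨μ.onE ⟨x, e, e'⟩, μ.p_onE ⟨x, e, e'⟩⟩, h' e⟩, h''⟩,
        e, ⟨μ.onE ⟨⟨x.top e, fun e' => d ⟨μ.onE ⟨x, e, e'⟩, μ.p_onE ⟨x, e, e'⟩⟩, h' e⟩, e', e''⟩,
          μ.p_onE ⟨⟨x.top e, fun e' => d ⟨μ.onE ⟨x, e, e'⟩, μ.p_onE ⟨x, e, e'⟩⟩, h' e⟩, e', e''⟩⟩⟩

/-! ### The set `tr(P)` and the Baez-Dolan construction -/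

/-- The set `tr(P)` of isomorphism classes of `P`-trees, fibred over `I` by the type of the root
edge, as the least fixpoint of `X ↦ I + P(X)`: a `P`-tree is a unit tree with its edge decorated by
some `i`, or it is an operation `b` at the root node with a `P`-tree of root type `s e` grafted onto
each input `e` of `b`. (`P`-trees are rigid, so that this describes their isomorphism classes.) -/
inductive PTree {I : Type u} (P : PolyEndo I) : I → Type u
  | unit (i : I) : PTree P i
  | node (b : P.B) (c : ∀ e : P.Fib b, PTree P (P.s e.1)) : PTree P (P.t b)

namespace PTree

/-- The dots (nodes) of a `P`-tree. -/
def Dot {I : Type u} {P : PolyEndo I} : {i : I} → PTree P i → Type u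
  | _, .unit _ => PEmpty
  | _, .node b c => Option (Σ e : P.Fib b, Dot (c e))

/-- The local bouquet around a dot, that is, the operation that decorates it. -/
def bouquet {I : Type u} {P : PolyEndo I} : {i : I} → (T : PTree P i) → T.Dot → P.B
  | _, .unit _ => fun x => x.elim
  | _, .node b c => fun (x : Option (Σ e : P.Fib b, Dot (c e))) =>
    x.elim b (fun y => bouquet (c y.1) y.2)

theorem finite_dot {I : Type u} {P : PolyEndo I} {i : I} (T : PTree P i) : Finite T.Dot := by
  induction T with
  | unit i => exact inferInstanceAs (Finite PEmpty)
  | node b c ih =>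
    have := P.finite_fibre b
    have : ∀ e, Finite (c e).Dot := ih
    exact inferInstanceAs (Finite (Option (Σ e : P.Fib b, (c e).Dot)))

/-- The total bouquet of a `P`-tree: the operation obtained from the monad structure of `P` by
contracting all inner edges, or by setting a new dot in a unit tree. It comes with the fact that
its output type is the type of the root edge. -/
def contract {I : Type u} (P : PolyMonad I) :
    {i : I} → PTree P.toPolyEndo i → {b : P.B // P.t b = i}
  | _, .unit i => ⟨P.η.onB i, P.η.t_onB i⟩
  | _, .node b c =>
    ⟨P.μ.onB ⟨b, fun e => (contract P (c e)).1, fun e => (contract P (c e)).2⟩, P.μ.t_onB _⟩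

end PTree

/-- (The polynomial endofunctor underlying) the Baez-Dolan construction `P⁺` on a polynomial monad
`P`, represented by `B ← tr•(P) → tr(P) → B`. Here `tr•(P)` is the set of `P`-trees with a marked
dot; the maps return the local bouquet of the marked dot, forget the mark, and return the total
bouquet of a `P`-tree. -/
def PolyMonad.plus {I : Type u} (P : PolyMonad I) : PolyEndo P.B where
  E := Σ T : (Σ i, PTree P.toPolyEndo i), T.2.Dot
  B := Σ i, PTree P.toPolyEndo i
  s x := x.1.2.bouquet x.2
  p x := x.1
  t T := (PTree.contract P T.2).1
  finite_fibre T := PolyEndo.finite_sigma_fibre (fun T => T.2.finite_dot) T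

/-! ### Abstract trees and their decorations -/

/-- A finite rooted tree with boundary, on the vertex set `V`: a finite graph, connected and
simply connected, with a pointed set of vertices of valence `1`, the boundary. -/
structure AbstractTree (V : Type v) where
  finite : Finite V
  graph : SimpleGraph V
  isTree : graph.IsTree
  boundary : Set V
  valence_boundary : ∀ x ∈ boundary, (graph.incidenceSet x).ncard = 1
  /-- The output vertex. -/
  root : V
  root_mem : root ∈ boundary

namespace AbstractTree

variable {V : Type v}

/-- The edges of the tree, including the root edge and the leaves. -/
abbrev Edge (T : AbstractTree V) : Type v := T.graph.edgeSet

/-- The nodes (dots): the vertices that do not belong to the boundary. -/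
abbrev Node (T : AbstractTree V) : Type v := {x : V // x ∉ T.boundary}

/-- The order on vertices, in which the output vertex is the maximal element:
`a ≤ b` if `b` lies on the path from `a` to the output vertex. -/
def Le (T : AbstractTree V) (a b : V) : Prop :=
  ∃ w : T.graph.Walk a T.root, w.IsPath ∧ b ∈ w.support

/-- `e` is the output edge of the node `n`: it joins `n` to a vertex of which `n` is a child. -/
def IsOutput (T : AbstractTree V) (n : T.Node) (e : T.Edge) : Prop :=
  ∃ y : V, e.1 = s(n.1, y) ∧ T.Le n.1 y

/-- `e` is an input edge of the node `n`: it is incident to `n` and is not its output edge. -/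
def IsInput (T : AbstractTree V) (n : T.Node) (e : T.Edge) : Prop :=
  n.1 ∈ e.1 ∧ ¬ T.IsOutput n e

/-- A decoration of the tree `T` by a polynomial endofunctor `Q` given by `J ← E → B → J` (for
a polynomial monad: by its underlying endofunctor). With it, `T` is a `Q`-tree: edges are decorated
in `J`, nodes are decorated in `B`, and for each node `n` with decoration `b` there is a bijection
from the input edges of `n` to `E_b`, such that an input edge that corresponds to `e` has decoration
`s e` and the output edge of `n` has decoration `t b`. -/
structure Decoration (T : AbstractTree V) {J : Type u} (Q : PolyEndo J) where
  onEdge : T.Edge → J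
  onNode : T.Node → Q.B
  inputEquiv : ∀ n : T.Node, {e : T.Edge // T.IsInput n e} ≃ Q.Fib (onNode n)
  onEdge_input : ∀ (n : T.Node) (e : {e : T.Edge // T.IsInput n e}),
    onEdge e.1 = Q.s (inputEquiv n e).1
  onEdge_output : ∀ (n : T.Node) (e : T.Edge), T.IsOutput n e → onEdge e = Q.t (onNode n)

end AbstractTree

/-! Fix a type `i` and decorate every edge of the abstract tree by the single operation `η i`. A
node with `n` input edges then needs a `P`-tree with `n` dots, all decorated by `η i`, that
contracts to `η i`. Since `η i` is unary with input and output of type `i`, `n` copies of it can be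
stacked into a linear tree, and the unit law contracts the stack to `η i`; for `n = 0` it is the
unit tree. As all edges and dots carry the same decoration, any bijection between inputs and dots is
compatible. -/

namespace PolyMonad

variable {I : Type u} (P : PolyMonad I)

/-- Unit operations are unary. -/
theorem existsUnique_input_unit (i : I) : ∃! _ : P.Fib (P.η.onB i), True := by
  refine ⟨⟨P.η.onE i, P.η.p_onE i⟩, trivial, ?_⟩
  rintro ⟨e, he⟩ -
  -- Cartesianness lifts `e` to the fibre of the identity over `i`, whose only element is `i`.
  obtain ⟨j, ⟨rfl, hj⟩, -⟩ := P.η.cartesian i e he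
  exact Subtype.ext hj.symm

/-- The input of a unit operation has the type of that unit. -/
theorem s_input_unit (i : I) (e : P.Fib (P.η.onB i)) : P.s e.1 = i := by
  rw [(P.existsUnique_input_unit i).unique (y₁ := e) (y₂ := ⟨P.η.onE i, P.η.p_onE i⟩)
    trivial trivial]
  exact P.η.s_onE i

/-- Linear trees of unit operations: for every `n` there is a `P`-tree with `n` dots, all of them
decorated by the unit operation of `i`, whose total bouquet is again the unit operation of `i`. -/
theorem exists_linear_unit_tree (n : ℕ) (i : I) :
    ∃ T : PTree P.toPolyEndo i, (PTree.contract P T).1 = P.η.onB i ∧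
      (∀ x : T.Dot, T.bouquet x = P.η.onB i) ∧ Nat.card T.Dot = n := by
  induction n generalizing i with
  | zero =>
    exact ⟨.unit i, rfl, fun x => PEmpty.elim x, Nat.card_of_isEmpty (α := PEmpty)⟩
  | succ n ih =>
    -- A `node` has index `P.t (P.η.onB i)`, which equals `i` only propositionally; freeing the
    -- index allows substitution instead of a cast.
    suffices ∀ j, P.t (P.η.onB i) = j →
        ∃ T : PTree P.toPolyEndo j, (PTree.contract P T).1 = P.η.onB i ∧
          (∀ x : T.Dot, T.bouquet x = P.η.onB i) ∧ Nat.card T.Dot = n + 1 from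
      this i (P.η.t_onB i)
    rintro _ rfl
    choose c hc hb hn using ih
    -- The subtree is chosen at type `P.s e.1`, not `i`, so that it fits definitionally and its
    -- contraction has the form required by `unit_top`.
    refine ⟨.node (P.η.onB i) fun e => c (P.s e.1), ?_, ?_, ?_⟩
    · have h := P.unit_top (P.η.onB i) fun e => P.η.t_onB _
      simpa only [PTree.contract, hc] using h
    · rintro (_ | ⟨e, x⟩)
      · rfl
      · exact (hb _ x).trans (congrArg P.η.onB (P.s_input_unit i e))
    -- With only one input, the dots above the root are those of a single subtree; the root adds
    -- one.
    · obtain ⟨e, -, he⟩ := P.existsUnique_input_unit i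
      let _ : Unique (P.Fib (P.η.onB i)) := ⟨⟨e⟩, fun e' => he e' trivial⟩
      have := (c (P.s (default : P.Fib (P.η.onB i)).1)).finite_dot
      have := Finite.of_equiv _ (Equiv.uniqueSigma
        fun e : P.Fib (P.η.onB i) => (c (P.s e.1)).Dot).symm
      calc Nat.card (Option (Σ e : P.Fib (P.η.onB i), (c (P.s e.1)).Dot))
        _ = Nat.card (Σ e : P.Fib (P.η.onB i), (c (P.s e.1)).Dot) + 1 := Finite.card_option
        _ = n + 1 := by rw [Nat.card_congr (Equiv.uniqueSigma _), hn]

end PolyMonad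

theorem mainTheorem6 {I : Type u} [Nonempty I] (P : PolyMonad I) {V : Type v}
    (T : AbstractTree V) : Nonempty (T.Decoration P.plus) := by
  obtain ⟨i⟩ := ‹Nonempty I›
  have := T.finite
  choose L hL hb hn using fun n => P.exists_linear_unit_tree n i
  -- Finiteness of `V` makes `Nat.card` the true number of inputs.
  let tree (n : T.Node) : P.plus.B := ⟨i, L (Nat.card {e : T.Edge // T.IsInput n e})⟩
  have equiv (n : T.Node) :
      Nonempty ({e : T.Edge // T.IsInput n e} ≃ P.plus.Fib (tree n)) := by
    have := (tree n).2.finite_dot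
    -- The inputs of an operation of `P.plus` are the possible marks on that tree.
    have marked : P.plus.Fib (tree n) ≃ (tree n).2.Dot :=
      Equiv.sigmaSubtype (β := fun S : P.plus.B => S.2.Dot) (tree n)
    exact ⟨(Finite.equivFin _).trans ((Finite.equivFinOfCardEq (hn _)).symm.trans marked.symm)⟩
  have bouquet_marked (n : T.Node) (y : P.plus.Fib (tree n)) : P.plus.s y.1 = P.η.onB i := by
    obtain ⟨⟨S, x⟩, hS⟩ := y
    obtain rfl : S = tree n := hS
    exact hb _ x
  exact ⟨⟨fun _ => P.η.onB i, tree, fun n => (equiv n).some,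
    fun n e => (bouquet_marked n _).symm, fun _ _ _ => (hL _).symm⟩⟩
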